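/- **Theorem 3.1.** Let $\mathcal F$ be a field, $n\ge 1$, $A_0,\dots,A_n\in\mathcal M(m_1\times r_1;\mathcal F)$, and write the difference equation $A_nX_{k+n}+\dots+A_1X_{k+1}+A_0X_k=0$ with $X_k\in\mathcal F^{r_1}$ as the first-order system $$F\,Y_{k+1}=G\,Y_k\quad(k\ge k_0),\qquad Y_k=\begin{bmatrix}X_k\\ \vdots\\ X_{k+n-1}\end{bmatrix},$$ $$F=\begin{bmatrix}I_{r_1}&&&\\&\ddots&&\\&&I_{r_1}&\\&&&A_n\end{bmatrix},\qquad G=\begin{bmatrix}0&I_{r_1}&&\\&\ddots&\ddots&\\&&0&I_{r_1}\\-A_0&-A_1&\cdots&-A_{n-1}\end{bmatrix},$$ with a given initial value $Y_{k_0}\in\mathcal F^{nr_1}$. Assume that the pencil $sF-G$ is singular, that is, it is not square or $\det(sF-G)=0$ identically. Let $P,Q$ be nonsingular matrices over $\mathcal F$ that bring the pencil to Kronecker canonical form, $$P(sF-G)Q=(sI_p-J_p)\oplus(sH_q-I_q)\oplus(sF_\epsilon-G_\epsilon)\oplus(sF_\zeta-G_\zeta)\oplus 0_{h,g}.$$ Here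 $J_p$ is a direct sum of Jordan blocks, $H_q$ is a direct sum of nilpotent Jordan blocks, $sF_\epsilon-G_\epsilon$ is a direct sum of blocks $s[\,I_e\mid 0\,]-[\,0\mid I_e\,]$ of size $e\times(e+1)$ with $e\ge1$, and $sF_\zeta-G_\zeta$ is a direct sum of transposes of such blocks. Partition the columns accordingly, $Q=[\,Q_p\;Q_q\;Q_\epsilon\;Q_\zeta\;Q_g\,]$, and let $\mathcal N_r(sF-G)$ be the right null space of $sF-G$ over the field $\mathcal F(s)$ of rational functions. 1. The initial value problem has exactly one solution $(Y_k)_{k\ge k_0}$ if and only if the pencil has no column minimal indices, i.e. $\dim\mathcal N_r(sF-G)=0$, and $Y_{k_0}\in\operatorname{colspan}Q_p$. 2. In that case the solution is $Y_k=Q_pJ_p^{\,k-k_0}Z^p_{k_0}$ for $k\ge k_0$, where $Z^p_{k_0}$ is the unique solution of the algebraic system $Y_{k_0}=Q_pZ^p_{k_0}$. 3. A solution exists if and only if $Y_{k_0}\in\operatorname{colspan}[\,Q_p\;Q_\epsilon\;Q_g\,]$. In every case other than that of part 1, if $Y_{k_0}$ is such a consistent initial value, there are infinitely many solutions. -/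

import Mathlib

open Matrix

/-! ## The first-order system

The homogeneous equation `A_n X_{k+n} + ... + A_1 X_{k+1} + A_0 X_k = 0`, with coefficients
`A_i` of size `m₁ × r₁` and unknown columns `X_k` of height `r₁`, is written as
`F Y_{k+1} = G Y_k`, where `Y_k` is the column of blocks `(X_k, ..., X_{k+n-1})`. -/

/-- Row indices of `F` and `G`: `n - 1` block rows of height `r₁` and a last one of height `m₁`. -/
abbrev SysRow (n m₁ r₁ : ℕ) : Type := (Fin (n - 1) × Fin r₁) ⊕ Fin m₁

/-- Column indices of `F` and `G`: `n` block columns of width `r₁`. -/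
abbrev SysCol (n r₁ : ℕ) : Type := Fin n × Fin r₁

/-- `F = blockdiag(I, ..., I, A_n)`. -/
def sysF {K : Type*} [Field K] {n m₁ r₁ : ℕ} (A : Fin (n + 1) → Matrix (Fin m₁) (Fin r₁) K) :
    Matrix (SysRow n m₁ r₁) (SysCol n r₁) K :=
  Matrix.of fun row col =>
    match row with
    | Sum.inl (i, a) => if i.val = col.1.val ∧ a = col.2 then 1 else 0
    | Sum.inr b => if col.1.val + 1 = n then A (Fin.last n) b col.2 else 0

/-- `G` has identity blocks on the block superdiagonal and last block row
`(-A_0, -A_1, ..., -A_{n-1})`. -/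
def sysG {K : Type*} [Field K] {n m₁ r₁ : ℕ} (A : Fin (n + 1) → Matrix (Fin m₁) (Fin r₁) K) :
    Matrix (SysRow n m₁ r₁) (SysCol n r₁) K :=
  Matrix.of fun row col =>
    match row with
    | Sum.inl (i, a) => if i.val + 1 = col.1.val ∧ a = col.2 then 1 else 0
    | Sum.inr b => -A col.1.castSucc b col.2

/-- `Y`, a sequence indexed by the integers `k ≥ k₀`, solves `F Y_{k+1} = G Y_k` for all
`k ≥ k₀`, with the prescribed initial value `Y_{k₀} = Y₀`. -/
def IsSolution {K : Type*} [Field K] {R C : Type*} [Fintype C] (F G : Matrix R C K)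
    (k₀ : ℤ) (Y₀ : C → K) (Y : Set.Ici k₀ → C → K) : Prop :=
  Y ⟨k₀, Set.mem_Ici.2 le_rfl⟩ = Y₀ ∧
    ∀ k : Set.Ici k₀,
      F *ᵥ Y ⟨k.1 + 1, Set.mem_Ici.2 ((Set.mem_Ici.1 k.2).trans (lt_add_one k.1).le)⟩ = G *ᵥ Y k

/-! ## Matrix pencils -/

/-- The pencil `sF - G`, as a matrix over the field `K(s)` of rational functions. -/
noncomputable def pencil {K : Type*} [Field K] {R C : Type*} (F G : Matrix R C K) :
    Matrix R C (RatFunc K) :=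
  (RatFunc.X : RatFunc K) • F.map (algebraMap K (RatFunc K)) - G.map (algebraMap K (RatFunc K))

/-- A pencil is regular if it is square (the bijection `e` identifies rows with columns; another
one changes the determinant only by a sign) with `det (sF - G) ≠ 0`. -/
def IsRegularPencil {K : Type*} [Field K] {R C : Type*} [Fintype C] [DecidableEq C]
    (F G : Matrix R C K) : Prop :=
  ∃ e : C ≃ R, ((pencil F G).submatrix e id).det ≠ 0

def IsSingularPencil {K : Type*} [Field K] {R C : Type*} [Fintype C] [DecidableEq C]
    (F G : Matrix R C K) : Prop :=
  ¬ IsRegularPencil F G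

/-- The right null space `N_r(sF - G)`, a vector space over `K(s)`. Its dimension is the number
of column minimal indices, the zero ones included. -/
noncomputable def rightNullSpace {K : Type*} [Field K] {R C : Type*} [Fintype C]
    (F G : Matrix R C K) : Submodule (RatFunc K) (C → RatFunc K) :=
  LinearMap.ker (pencil F G).mulVecLin

/-! ## The Kronecker canonical form -/

/-- The invariants listed in a Kronecker canonical form: finite elementary divisors
`(s - a j) ^ p j`, infinite elementary divisors of degrees `q j`, nonzero column minimal indices
`ε i`, nonzero row minimal indices `ζ i`, and the numbers `g`, `h` of zero column and row minimal
indices. The order inside each list is immaterial. -/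
structure KroneckerInvariants (K : Type*) where
  (ν σ c t g h : ℕ)
  a : Fin ν → K
  p : Fin ν → ℕ
  q : Fin σ → ℕ
  ε : Fin c → ℕ
  ζ : Fin t → ℕ
  p_pos : ∀ j, 0 < p j
  q_pos : ∀ j, 0 < q j
  ε_pos : ∀ i, 0 < ε i
  ζ_pos : ∀ i, 0 < ζ i

/-- The upper triangular Jordan block of size `n` with eigenvalue `a`. -/
def jordanBlock {K : Type*} [Field K] (a : K) (n : ℕ) : Matrix (Fin n) (Fin n) K :=
  Matrix.of fun i j => if i = j then a else if i.val + 1 = j.val then 1 else 0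

/-- `[ I_e | 0 ]`, of size `e × (e + 1)`. -/
def blockL (K : Type*) [Field K] (e : ℕ) : Matrix (Fin e) (Fin (e + 1)) K :=
  Matrix.of fun i j => if j = i.castSucc then 1 else 0

/-- `[ 0 | I_e ]`, of size `e × (e + 1)`. -/
def blockLbar (K : Type*) [Field K] (e : ℕ) : Matrix (Fin e) (Fin (e + 1)) K :=
  Matrix.of fun i j => if j = i.succ then 1 else 0

namespace KroneckerInvariants

variable {K : Type*} (κ : KroneckerInvariants K)

abbrev IdxP : Type := Σ j : Fin κ.ν, Fin (κ.p j)
abbrev IdxQ : Type := Σ j : Fin κ.σ, Fin (κ.q j)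
abbrev RowEps : Type := Σ i : Fin κ.c, Fin (κ.ε i)
abbrev ColEps : Type := Σ i : Fin κ.c, Fin (κ.ε i + 1)
abbrev RowZeta : Type := Σ i : Fin κ.t, Fin (κ.ζ i + 1)
abbrev ColZeta : Type := Σ i : Fin κ.t, Fin (κ.ζ i)

/-- Row indices of the canonical form. -/
abbrev Row : Type := κ.IdxP ⊕ κ.IdxQ ⊕ κ.RowEps ⊕ κ.RowZeta ⊕ Fin κ.h

/-- Column indices of the canonical form. -/
abbrev Col : Type := κ.IdxP ⊕ κ.IdxQ ⊕ κ.ColEps ⊕ κ.ColZeta ⊕ Fin κ.g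

variable [Field K]

/-- `J_p`, the direct sum of the Jordan blocks of the finite elementary divisors. -/
def Jp : Matrix κ.IdxP κ.IdxP K :=
  Matrix.blockDiagonal' fun j => jordanBlock (κ.a j) (κ.p j)

/-- `H_q`, the direct sum of the nilpotent blocks of the infinite elementary divisors. -/
def Hq : Matrix κ.IdxQ κ.IdxQ K :=
  Matrix.blockDiagonal' fun j => jordanBlock (0 : K) (κ.q j)

def Feps : Matrix κ.RowEps κ.ColEps K := Matrix.blockDiagonal' fun i => blockL K (κ.ε i)
def Geps : Matrix κ.RowEps κ.ColEps K := Matrix.blockDiagonal' fun i => blockLbar K (κ.ε i)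

/-- The blocks of `F_ζ` are `I_ζ` above a zero row. -/
def Fzeta : Matrix κ.RowZeta κ.ColZeta K := Matrix.blockDiagonal' fun i => (blockL K (κ.ζ i))ᵀ

/-- The blocks of `G_ζ` are `I_ζ` below a zero row. -/
def Gzeta : Matrix κ.RowZeta κ.ColZeta K := Matrix.blockDiagonal' fun i => (blockLbar K (κ.ζ i))ᵀ

/-- `F_K = I_p ⊕ H_q ⊕ F_ε ⊕ F_ζ ⊕ 0_{h,g}`. -/
def FK : Matrix κ.Row κ.Col K :=
  fromBlocks 1 0 0 (fromBlocks κ.Hq 0 0 (fromBlocks κ.Feps 0 0 (fromBlocks κ.Fzeta 0 0 0)))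

/-- `G_K = J_p ⊕ I_q ⊕ G_ε ⊕ G_ζ ⊕ 0_{h,g}`. -/
def GK : Matrix κ.Row κ.Col K :=
  fromBlocks κ.Jp 0 0 (fromBlocks 1 0 0 (fromBlocks κ.Geps 0 0 (fromBlocks κ.Gzeta 0 0 0)))

/-- The columns `Q_p` of `Q = [Q_p Q_q Q_ε Q_ζ Q_g]`. -/
def Qp {C : Type*} (Q : Matrix C κ.Col K) : Matrix C κ.IdxP K :=
  Q.submatrix id Sum.inl

/-- The columns `Q_ε` of `Q = [Q_p Q_q Q_ε Q_ζ Q_g]`. -/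
def Qeps {C : Type*} (Q : Matrix C κ.Col K) : Matrix C κ.ColEps K :=
  Q.submatrix id fun i => Sum.inr (Sum.inr (Sum.inl i))

/-- The columns `Q_g` of `Q = [Q_p Q_q Q_ε Q_ζ Q_g]`. -/
def Qg {C : Type*} (Q : Matrix C κ.Col K) : Matrix C (Fin κ.g) K :=
  Q.submatrix id fun i => Sum.inr (Sum.inr (Sum.inr (Sum.inr i)))

end KroneckerInvariants

/-- Nonsingularity of a matrix whose rows and columns are labelled by possibly different types
(which then have the same number of elements). -/
def IsNonsingular {K : Type*} [Field K] {R C : Type*} [Fintype R] [Fintype C]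
    [DecidableEq R] [DecidableEq C] (M : Matrix R C K) : Prop :=
  ∃ N : Matrix C R K, M * N = 1 ∧ N * M = 1

/-- The nonsingular matrices `P`, `Q` transform `sF - G` to the Kronecker canonical form with
invariants `κ`: `P F Q = F_K` and `P G Q = G_K`. -/
structure IsKroneckerTransformation {K : Type*} [Field K] {R C : Type*} [Fintype R] [Fintype C]
    [DecidableEq R] [DecidableEq C] (F G : Matrix R C K) (κ : KroneckerInvariants K)
    (P : Matrix κ.Row R K) (Q : Matrix C κ.Col K) : Prop where
  nonsingular_P : IsNonsingular P
  nonsingular_Q : IsNonsingular Q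
  transform_F : P * F * Q = κ.FK
  transform_G : P * G * Q = κ.GK

/-- The column span of a matrix. -/
def colspan {K : Type*} [Field K] {R C : Type*} (M : Matrix R C K) : Submodule K (R → K) :=
  Submodule.span K (Set.range M.col)

/-! The substitution `Y = Q Z`, with `P` applied from the left, splits the system into independent
systems, one per block type (`recurrence_iff`). The `p` part is `Z (m+1) = J_p Z m`, so its initial
value determines it. The `q` and `ζ` parts can only vanish: each entry equals a later entry of the
block at a later time, down to a last one that is zero. An `ε` block slides a window of length `ε i
+ 1` along a scalar sequence: the initial value fixes the first window, and every later term is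
free. The `g` components are free after the initial time. Hence solvability means that the `q` and
`ζ` components of `Q⁻¹ Y₀` vanish, and a solution is unique exactly when `c = g = 0`. The same
splitting over `K(s)` shows that `c = g = 0` is triviality of the null space
(`canonical_null_space_trivial_iff`). -/

/-! ### Recurrences of the individual Kronecker blocks -/

section Blocks

variable {K : Type*} [Field K]

theorem blockDiagonal'_mulVec_apply {ι : Type*} [Fintype ι] [DecidableEq ι] {m n : ι → Type*}
    [∀ i, Fintype (n i)] (M : ∀ i, Matrix (m i) (n i) K) (v : (Σ i, n i) → K) (i : ι) (a : m i) :
    (blockDiagonal' M *ᵥ v) ⟨i, a⟩ = (M i *ᵥ fun b => v ⟨i, b⟩) a := by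
  simp only [mulVec, dotProduct, Fintype.sum_sigma]
  rw [Finset.sum_eq_single i]
  · simp [blockDiagonal'_apply_eq]
  · intro j _ hj
    exact Finset.sum_eq_zero fun b _ => by
      rw [blockDiagonal'_apply_ne _ _ _ hj.symm, zero_mul]
  · simp

theorem jordanBlock_zero_mulVec_of_lt {n : ℕ} (v : Fin n → K) (i : Fin n) (h : i.val + 1 < n) :
    (jordanBlock (0 : K) n *ᵥ v) i = v ⟨i + 1, h⟩ := by
  simp only [mulVec, dotProduct]
  rw [Finset.sum_eq_single ⟨i + 1, h⟩]
  · have : i ≠ ⟨i + 1, h⟩ := fun e => by simpa using congrArg Fin.val e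
    simp [jordanBlock, this]
  · intro j _ hj
    have : ¬ i.val + 1 = j.val := fun e => hj (Fin.ext e.symm)
    simp [jordanBlock, this]
  · simp

theorem jordanBlock_zero_mulVec_of_eq {n : ℕ} (v : Fin n → K) (i : Fin n) (h : i.val + 1 = n) :
    (jordanBlock (0 : K) n *ᵥ v) i = 0 := by
  simp only [mulVec, dotProduct]
  refine Finset.sum_eq_zero fun j _ => ?_
  have : ¬ i.val + 1 = j.val := by omega
  simp [jordanBlock, this]

theorem blockL_mulVec {e : ℕ} (v : Fin (e + 1) → K) (i : Fin e) :
    (blockL K e *ᵥ v) i = v i.castSucc := by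
  simp [mulVec, dotProduct, blockL]

theorem blockLbar_mulVec {e : ℕ} (v : Fin (e + 1) → K) (i : Fin e) :
    (blockLbar K e *ᵥ v) i = v i.succ := by
  simp [mulVec, dotProduct, blockLbar]

theorem blockL_transpose_mulVec_castSucc {e : ℕ} (v : Fin e → K) (i : Fin e) :
    ((blockL K e)ᵀ *ᵥ v) i.castSucc = v i := by
  simp [mulVec, dotProduct, blockL]

theorem blockL_transpose_mulVec_last {e : ℕ} (v : Fin e → K) :
    ((blockL K e)ᵀ *ᵥ v) (Fin.last e) = 0 := by
  simp only [mulVec, dotProduct]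
  exact Finset.sum_eq_zero fun j _ => by simp [blockL, (Fin.castSucc_lt_last j).ne']

theorem blockLbar_transpose_mulVec_succ {e : ℕ} (v : Fin e → K) (i : Fin e) :
    ((blockLbar K e)ᵀ *ᵥ v) i.succ = v i := by
  simp [mulVec, dotProduct, blockLbar]

/-- A sequence driven backwards by nilpotent Jordan blocks vanishes. -/
theorem eq_zero_of_nilpotent_recurrence {σ : ℕ} {q : Fin σ → ℕ}
    {Z : ℕ → (Σ j : Fin σ, Fin (q j)) → K}
    (h : ∀ m, blockDiagonal' (fun j => jordanBlock (0 : K) (q j)) *ᵥ Z (m + 1) = Z m) (m : ℕ) :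
    Z m = 0 := by
  -- `d` is the distance to the last entry of the block. The time stays quantified because each step
  -- up the block moves one time ahead.
  have key : ∀ (j : Fin σ) (d : ℕ) (i : Fin (q j)), i.val + d + 1 = q j → ∀ m, Z m ⟨j, i⟩ = 0 := by
    intro j d
    induction d with
    | zero =>
      intro i hi m
      rw [← h m, blockDiagonal'_mulVec_apply, jordanBlock_zero_mulVec_of_eq _ _ (by omega)]
    | succ d ih =>
      intro i hi m
      rw [← h m, blockDiagonal'_mulVec_apply, jordanBlock_zero_mulVec_of_lt _ _ (by omega)]
      exact ih _ (by simp only; omega) _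
  ext ⟨j, i⟩
  exact key j (q j - i - 1) i (by omega) m

/-- Transposed singular blocks admit only the zero sequence. -/
theorem eq_zero_of_transpose_recurrence {t : ℕ} {ζ : Fin t → ℕ}
    {Z : ℕ → (Σ i : Fin t, Fin (ζ i)) → K}
    (h : ∀ m, blockDiagonal' (fun i => (blockL K (ζ i))ᵀ) *ᵥ Z (m + 1) =
      blockDiagonal' (fun i => (blockLbar K (ζ i))ᵀ) *ᵥ Z m) (m : ℕ) :
    Z m = 0 := by
  -- Row `a + 1` equates entry `a` now with entry `a + 1` one step later; the last row has zero on
  -- the left.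
  have key : ∀ (i : Fin t) (d : ℕ) (a : Fin (ζ i)), a.val + d + 1 = ζ i → ∀ m, Z m ⟨i, a⟩ = 0 := by
    intro i d
    induction d with
    | zero =>
      intro a ha m
      have e := congrFun (h m) ⟨i, a.succ⟩
      rw [blockDiagonal'_mulVec_apply, blockDiagonal'_mulVec_apply,
        blockLbar_transpose_mulVec_succ] at e
      rw [← e, show a.succ = Fin.last _ from Fin.ext (by simpa using ha),
        blockL_transpose_mulVec_last]
    | succ d ih =>
      intro a ha m
      have e := congrFun (h m) ⟨i, a.succ⟩
      rw [blockDiagonal'_mulVec_apply, blockDiagonal'_mulVec_apply,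
        blockLbar_transpose_mulVec_succ] at e
      have hlt : a.val + 1 < ζ i := by omega
      rw [← e, show a.succ = (⟨a.val + 1, hlt⟩ : Fin (ζ i)).castSucc from Fin.ext rfl,
        blockL_transpose_mulVec_castSucc]
      exact ih _ (by simp only; omega) _
  ext ⟨i, a⟩
  exact key i (ζ i - a - 1) a (by omega) m

/-- A shift register: the last new entry of each block is unconstrained, which is the source of
non-uniqueness. -/
theorem singular_recurrence_iff {c : ℕ} {ε : Fin c → ℕ}
    (z' z : (Σ i : Fin c, Fin (ε i + 1)) → K) :
    blockDiagonal' (fun i => blockL K (ε i)) *ᵥ z' =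
        blockDiagonal' (fun i => blockLbar K (ε i)) *ᵥ z ↔
      ∀ (i : Fin c) (a : Fin (ε i)), z' ⟨i, a.castSucc⟩ = z ⟨i, a.succ⟩ := by
  rw [funext_iff, Sigma.forall]
  simp only [blockDiagonal'_mulVec_apply, blockL_mulVec, blockLbar_mulVec]

theorem jordanBlock_map {L : Type*} [Field L] (f : K →+* L) (a : K) (n : ℕ) :
    (jordanBlock a n).map f = jordanBlock (f a) n := by
  ext i j
  simp only [jordanBlock, map_apply, of_apply]
  split_ifs <;> simp

theorem blockL_map {L : Type*} [Field L] (f : K →+* L) (e : ℕ) :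
    (blockL K e).map f = blockL L e := by
  ext i j
  simp only [blockL, map_apply, of_apply]
  split_ifs <;> simp

theorem blockLbar_map {L : Type*} [Field L] (f : K →+* L) (e : ℕ) :
    (blockLbar K e).map f = blockLbar L e := by
  ext i j
  simp only [blockLbar, map_apply, of_apply]
  split_ifs <;> simp

/-- No element transcendental over `K` is an eigenvalue of a matrix over `K`. -/
theorem eq_zero_of_X_smul_eq_mulVec {ι : Type*} [Fintype ι] [DecidableEq ι] (J : Matrix ι ι K)
    {z : ι → RatFunc K}
    (h : (RatFunc.X : RatFunc K) • z = J.map (algebraMap K (RatFunc K)) *ᵥ z) : z = 0 := by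
  set J' := J.map (algebraMap K (RatFunc K))
  -- This determinant is the characteristic polynomial of `J` read in `K(s)`, nonzero because it is
  -- monic.
  have hdet : (scalar ι (RatFunc.X : RatFunc K) - J').det ≠ 0 := by
    rw [← eval_charpoly, charpoly_map, Polynomial.eval_map_algebraMap]
    have : Polynomial.aeval (RatFunc.X : RatFunc K) J.charpoly =
        algebraMap (Polynomial K) (RatFunc K) J.charpoly := by
      rw [← RatFunc.algebraMap_X, Polynomial.aeval_algebraMap_apply, Polynomial.aeval_X_left_apply]
    rw [this]
    exact RatFunc.algebraMap_ne_zero J.charpoly_monic.ne_zero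
  apply eq_zero_of_mulVec_eq_zero hdet
  rw [sub_mulVec, ← h, sub_eq_zero]
  ext i
  simp [scalar_apply, mulVec_diagonal]

end Blocks

/-! ### Strict equivalence -/

section Transformation

variable {K : Type*} [Field K] {R C R' C' : Type*} [Fintype R] [Fintype C] [Fintype R']
  [Fintype C'] [DecidableEq R]

theorem mulVec_eq_mulVec_iff_of_equivalence {F G : Matrix R C K} {P : Matrix R' R K}
    {N : Matrix R R' K} {Q : Matrix C C' K} (hP : N * P = 1) (a b : C' → K) :
    F *ᵥ (Q *ᵥ a) = G *ᵥ (Q *ᵥ b) ↔ (P * F * Q) *ᵥ a = (P * G * Q) *ᵥ b := by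
  simp only [← mulVec_mulVec]
  refine ⟨fun h => by rw [h], fun h => ?_⟩
  have := congrArg (N *ᵥ ·) h
  simpa [mulVec_mulVec, ← Matrix.mul_assoc, hP] using this

end Transformation

/-! ### Reindexing time by the natural numbers -/

section Time

/-- The times `k ≥ k₀`, counted from `k₀`. -/
def timeEquiv (k₀ : ℤ) : ℕ ≃ Set.Ici k₀ where
  toFun m := ⟨k₀ + m, Set.mem_Ici.2 (by omega)⟩
  invFun k := (k.1 - k₀).toNat
  left_inv m := by simp
  right_inv k := by
    have := Set.mem_Ici.1 k.2
    exact Subtype.ext (by simp only; omega)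

theorem isSolution_iff_nat {K : Type*} [Field K] {R C : Type*} [Fintype C] {F G : Matrix R C K}
    {k₀ : ℤ} {Y₀ : C → K} {Y : Set.Ici k₀ → C → K} :
    IsSolution F G k₀ Y₀ Y ↔ Y (timeEquiv k₀ 0) = Y₀ ∧
      ∀ m, F *ᵥ Y (timeEquiv k₀ (m + 1)) = G *ᵥ Y (timeEquiv k₀ m) := by
  unfold IsSolution
  refine and_congr ?_ ?_
  · rw [show timeEquiv k₀ 0 = ⟨k₀, Set.mem_Ici.2 le_rfl⟩ from Subtype.ext (by simp [timeEquiv])]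
  · rw [← (timeEquiv k₀).forall_congr_right]
    refine forall_congr' fun m => ?_
    rw [show timeEquiv k₀ (m + 1) = ⟨(timeEquiv k₀ m).1 + 1, _⟩ from
      Subtype.ext (by simp [timeEquiv, add_assoc])]

end Time

/-! ### The canonical system -/

namespace KroneckerInvariants

variable {K : Type*} (κ : KroneckerInvariants K)

/-- The vector with the given `p`, `ε` and `g` components, the others being zero. -/
def colVec {M : Type*} [Zero M] (a : κ.IdxP → M) (b : κ.ColEps → M) (d : Fin κ.g → M) :
    κ.Col → M :=
  Sum.elim a (Sum.elim 0 (Sum.elim b (Sum.elim 0 d)))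

/-- The vectors whose `q` and `ζ` components vanish. -/
def IsConsistent {M : Type*} [Zero M] (z : κ.Col → M) : Prop :=
  (∀ i, z (.inr (.inl i)) = 0) ∧ ∀ i, z (.inr (.inr (.inr (.inl i)))) = 0

variable {κ} in
theorem IsConsistent.eq_colVec {M : Type*} [Zero M] {z : κ.Col → M} (hz : κ.IsConsistent z) :
    z = κ.colVec (fun i => z (.inl i)) (fun i => z (.inr (.inr (.inl i))))
      (fun i => z (.inr (.inr (.inr (.inr i))))) := by
  ext (i | i | i | i | i)
  · rfl
  · exact hz.1 i
  · rfl
  · exact hz.2 i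
  · rfl

variable [Field K]

theorem mulVec_colVec {C : Type*} (Q : Matrix C κ.Col K) (a : κ.IdxP → K) (b : κ.ColEps → K)
    (d : Fin κ.g → K) :
    Q *ᵥ κ.colVec a b d = κ.Qp Q *ᵥ a + κ.Qeps Q *ᵥ b + κ.Qg Q *ᵥ d := by
  ext i
  simp [mulVec, dotProduct, colVec, Qp, Qeps, Qg, Fintype.sum_sum_type, add_assoc]

theorem mulVec_colVec_zero_zero {C : Type*} (Q : Matrix C κ.Col K) (a : κ.IdxP → K) :
    Q *ᵥ κ.colVec a 0 0 = κ.Qp Q *ᵥ a := by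
  simp [mulVec_colVec]

theorem Qp_mulVec_injective {C : Type*} [Fintype C] {Q : Matrix C κ.Col K}
    {N : Matrix κ.Col C K} (hNQ : N * Q = 1) :
    Function.Injective (κ.Qp Q *ᵥ ·) := by
  intro a b e
  simp only [← κ.mulVec_colVec_zero_zero] at e
  have := congrArg (N *ᵥ ·) e
  simp only [mulVec_mulVec, hNQ, one_mulVec] at this
  exact funext fun i => congrFun this (.inl i)

/-- The field map `f` lets one splitting serve both the sequences over `K` and the null vectors over
`K(s)`. The `g` components do not enter the equations. -/
theorem recurrence_map_iff {L : Type*} [Field L] (f : K →+* L) (z' z : κ.Col → L) :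
    κ.FK.map f *ᵥ z' = κ.GK.map f *ᵥ z ↔
      (fun i => z' (.inl i)) = κ.Jp.map f *ᵥ (fun i => z (.inl i)) ∧
      blockDiagonal' (fun j => jordanBlock (0 : L) (κ.q j)) *ᵥ (fun i => z' (.inr (.inl i))) =
        (fun i => z (.inr (.inl i))) ∧
      (∀ i (a : Fin (κ.ε i)), z' (.inr (.inr (.inl ⟨i, a.castSucc⟩))) =
        z (.inr (.inr (.inl ⟨i, a.succ⟩)))) ∧
      blockDiagonal' (fun i => (blockL L (κ.ζ i))ᵀ) *ᵥ
          (fun i => z' (.inr (.inr (.inr (.inl i))))) =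
        blockDiagonal' (fun i => (blockLbar L (κ.ζ i))ᵀ) *ᵥ
          (fun i => z (.inr (.inr (.inr (.inl i))))) := by
  have hone {ι : Type} [DecidableEq ι] : (1 : Matrix ι ι K).map f = 1 :=
    Matrix.map_one f (map_zero f) (map_one f)
  have hε := singular_recurrence_iff (K := L) (ε := κ.ε) (fun i => z' (.inr (.inr (.inl i))))
    (fun i => z (.inr (.inr (.inl i))))
  rw [← hε]
  simp only [FK, GK, Hq, Feps, Geps, Fzeta, Gzeta, fromBlocks_map, hone,
    blockDiagonal'_map _ _ (map_zero f), transpose_map, jordanBlock_map, blockL_map,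
    blockLbar_map, map_zero, Matrix.map_zero _ (map_zero f),
    fromBlocks_mulVec, zero_mulVec, add_zero, zero_add, one_mulVec, Sum.elim_eq_iff, and_true]
  rfl

theorem recurrence_iff (z' z : κ.Col → K) :
    κ.FK *ᵥ z' = κ.GK *ᵥ z ↔
      (fun i => z' (.inl i)) = κ.Jp *ᵥ (fun i => z (.inl i)) ∧
      blockDiagonal' (fun j => jordanBlock (0 : K) (κ.q j)) *ᵥ (fun i => z' (.inr (.inl i))) =
        (fun i => z (.inr (.inl i))) ∧
      (∀ i (a : Fin (κ.ε i)), z' (.inr (.inr (.inl ⟨i, a.castSucc⟩))) =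
        z (.inr (.inr (.inl ⟨i, a.succ⟩)))) ∧
      blockDiagonal' (fun i => (blockL K (κ.ζ i))ᵀ) *ᵥ
          (fun i => z' (.inr (.inr (.inr (.inl i))))) =
        blockDiagonal' (fun i => (blockLbar K (κ.ζ i))ᵀ) *ᵥ
          (fun i => z (.inr (.inr (.inr (.inl i))))) := by
  simpa using κ.recurrence_map_iff (RingHom.id K) z' z

theorem isConsistent_of_recurrence_map {L : Type*} [Field L] (f : K →+* L) {Z : ℕ → κ.Col → L}
    (h : ∀ m, κ.FK.map f *ᵥ Z (m + 1) = κ.GK.map f *ᵥ Z m) (m : ℕ) : κ.IsConsistent (Z m) := by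
  simp only [recurrence_map_iff] at h
  exact ⟨congrFun (eq_zero_of_nilpotent_recurrence
      (Z := fun m i => Z m (.inr (.inl i))) (fun m => (h m).2.1) m),
    congrFun (eq_zero_of_transpose_recurrence
      (Z := fun m i => Z m (.inr (.inr (.inr (.inl i))))) (fun m => (h m).2.2.2) m)⟩

theorem isConsistent_of_recurrence {Z : ℕ → κ.Col → K}
    (h : ∀ m, κ.FK *ᵥ Z (m + 1) = κ.GK *ᵥ Z m) (m : ℕ) : κ.IsConsistent (Z m) :=
  κ.isConsistent_of_recurrence_map (RingHom.id K) (by simpa using h) m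

theorem finite_part_of_recurrence {Z : ℕ → κ.Col → K}
    (h : ∀ m, κ.FK *ᵥ Z (m + 1) = κ.GK *ᵥ Z m) (m : ℕ) :
    (fun i => Z m (.inl i)) = κ.Jp ^ m *ᵥ fun i => Z 0 (.inl i) := by
  induction m with
  | zero => simp
  | succ m ih => rw [((κ.recurrence_iff _ _).1 (h m)).1, ih, mulVec_mulVec, pow_succ']

/-- The sequence that drives the block `i` of the `ε` part: given initially, then free. -/
def epsDriver (z₀ : κ.Col → K) (u : ℕ → K) (i : Fin κ.c) (l : ℕ) : K :=
  if h : l < κ.ε i + 1 then z₀ (.inr (.inr (.inl ⟨i, l, h⟩))) else u l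

/-- The solution of the canonical system with initial value `z₀` in which the undetermined
components at time `m` are prescribed by the sequence `u`. -/
def freeSolution (z₀ : κ.Col → K) (u : ℕ → K) (m : ℕ) : κ.Col → K :=
  κ.colVec (κ.Jp ^ m *ᵥ fun i => z₀ (.inl i))
    (fun x => κ.epsDriver z₀ u x.1 (m + x.2))
    (fun i => if m = 0 then z₀ (.inr (.inr (.inr (.inr i)))) else u m)

variable {κ} in
theorem freeSolution_zero {z₀ : κ.Col → K} (hz : κ.IsConsistent z₀) (u : ℕ → K) :
    κ.freeSolution z₀ u 0 = z₀ := by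
  rw [hz.eq_colVec, freeSolution]
  congr 1
  · simp [colVec]
  · ext ⟨i, a⟩
    have := a.2
    simp [epsDriver, colVec, show ¬ κ.ε i < a.val by omega]

theorem freeSolution_recurrence (z₀ : κ.Col → K) (u : ℕ → K) (m : ℕ) :
    κ.FK *ᵥ κ.freeSolution z₀ u (m + 1) = κ.GK *ᵥ κ.freeSolution z₀ u m := by
  rw [recurrence_iff]
  refine ⟨?_, ?_, ?_, ?_⟩
  · change κ.Jp ^ (m + 1) *ᵥ _ = κ.Jp *ᵥ (κ.Jp ^ m *ᵥ _)
    rw [mulVec_mulVec, pow_succ']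
  · change blockDiagonal' _ *ᵥ (0 : κ.IdxQ → K) = 0
    simp
  · intro i a
    -- Both sides read the driver at the same index, since `(m + 1) + a = m + (a + 1)`.
    change κ.epsDriver z₀ u i _ = κ.epsDriver z₀ u i _
    congr 1
    simp only [Fin.val_castSucc, Fin.val_succ]
    omega
  · change blockDiagonal' _ *ᵥ (0 : κ.ColZeta → K) = blockDiagonal' _ *ᵥ (0 : κ.ColZeta → K)
    simp

/-- If there is a column minimal index, then a solution of the canonical system shows the free
sequence from some time on. -/
theorem exists_eq_of_freeSolution_eq (h : ¬ (κ.c = 0 ∧ κ.g = 0)) (z₀ : κ.Col → K) :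
    ∃ B : ℕ, ∀ u u' : ℕ → K, κ.freeSolution z₀ u = κ.freeSolution z₀ u' →
      ∀ l, B ≤ l → u l = u' l := by
  by_cases hc : κ.c = 0
  · have hg : 0 < κ.g := by omega
    refine ⟨1, fun u u' e l hl => ?_⟩
    have := congrFun (congrFun e l) (.inr (.inr (.inr (.inr ⟨0, hg⟩))))
    simpa [freeSolution, colVec, show l ≠ 0 by omega] using this
  · let i : Fin κ.c := ⟨0, by omega⟩
    -- Entry `0` of the block at time `l` is term `l` of the driver, which is free once `l > ε i`.
    refine ⟨κ.ε i + 1, fun u u' e l hl => ?_⟩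
    have := congrFun (congrFun e l) (.inr (.inr (.inl ⟨i, 0⟩)))
    simpa [freeSolution, colVec, epsDriver, show ¬ l ≤ κ.ε i by omega] using this

theorem infinite_recurrence_solutions (h : ¬ (κ.c = 0 ∧ κ.g = 0)) {z₀ : κ.Col → K}
    (hz : κ.IsConsistent z₀) :
    {Z : ℕ → κ.Col → K | Z 0 = z₀ ∧ ∀ m, κ.FK *ᵥ Z (m + 1) = κ.GK *ᵥ Z m}.Infinite := by
  obtain ⟨B, hB⟩ := κ.exists_eq_of_freeSolution_eq h z₀
  -- Unit impulses at the times `B + N` give infinitely many solutions even over a finite field.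
  refine Set.infinite_of_injective_forall_mem
    (f := fun N : ℕ => κ.freeSolution z₀ (Pi.single (B + N) 1)) (fun N N' e => ?_)
    fun N => ⟨freeSolution_zero hz _, κ.freeSolution_recurrence z₀ _⟩
  by_contra hne
  have := hB _ _ e (B + N) (by omega)
  simp [hne] at this

/-- The right null space of the canonical pencil is trivial iff there are no column minimal
indices. -/
theorem canonical_null_space_trivial_iff :
    (∀ z : κ.Col → RatFunc K, κ.FK.map (algebraMap K (RatFunc K)) *ᵥ (RatFunc.X (K := K) • z) =
      κ.GK.map (algebraMap K (RatFunc K)) *ᵥ z → z = 0) ↔ κ.c = 0 ∧ κ.g = 0 := by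
  constructor
  · intro h
    by_contra hne
    -- On each `ε` block, `(1, s, ..., s ^ ε)` is a null vector of the pencil; the `g` entries are
    -- arbitrary.
    have hz := h (κ.colVec 0 (fun x => RatFunc.X ^ x.2.val) 1) (by
      rw [recurrence_map_iff]
      refine ⟨?_, ?_, ?_, ?_⟩
      · simp only [Pi.smul_apply, colVec, Sum.elim_inl, Pi.zero_apply, smul_zero]
        change (0 : κ.IdxP → RatFunc K) = _ *ᵥ (0 : κ.IdxP → RatFunc K)
        exact (mulVec_zero _).symm
      · simp only [Pi.smul_apply, colVec, Sum.elim_inr, Sum.elim_inl, Pi.zero_apply, smul_zero]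
        change _ *ᵥ (0 : κ.IdxQ → RatFunc K) = 0
        exact mulVec_zero _
      · intro i a
        simp [colVec, pow_succ']
      · simp only [Pi.smul_apply, colVec, Sum.elim_inr, Sum.elim_inl, Pi.zero_apply, smul_zero]
        change _ *ᵥ (0 : κ.ColZeta → RatFunc K) = _ *ᵥ (0 : κ.ColZeta → RatFunc K)
        rw [mulVec_zero, mulVec_zero])
    by_cases hc : κ.c = 0
    · have := congrFun hz (.inr (.inr (.inr (.inr ⟨0, by omega⟩))))
      simp [colVec] at this
    · have := congrFun hz (.inr (.inr (.inl ⟨⟨0, by omega⟩, 0⟩)))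
      simp [colVec] at this
  · rintro ⟨hc, hg⟩ z hz
    -- A null vector `z` yields the sequence `s ^ m • z`, which solves the recurrence over `K(s)`.
    have hcons := κ.isConsistent_of_recurrence_map (algebraMap K (RatFunc K))
      (Z := fun m => (RatFunc.X (K := K)) ^ m • z)
      (fun m => by
        simp only [pow_succ, mul_smul, mulVec_smul] at hz ⊢
        rw [hz]) 0
    simp only [pow_zero, one_smul] at hcons
    have hp : (fun i => z (.inl i)) = 0 :=
      eq_zero_of_X_smul_eq_mulVec κ.Jp ((κ.recurrence_map_iff _ _ _).1 hz).1
    ext (i | i | i | i | i)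
    · exact congrFun hp i
    · exact hcons.1 i
    · exact absurd i.1.2 (by omega)
    · exact hcons.2 i
    · exact absurd i.2 (by omega)

end KroneckerInvariants

/-! ### Transfer to the original pencil -/

theorem mem_colspan_iff {K : Type*} [Field K] {R C : Type*} [Fintype C] {M : Matrix R C K}
    {y : R → K} : y ∈ colspan M ↔ ∃ z, M *ᵥ z = y := by
  rw [colspan, ← range_mulVecLin]
  rfl

theorem mem_rightNullSpace_iff {K : Type*} [Field K] {R C : Type*} [Fintype C]
    {F G : Matrix R C K} {x : C → RatFunc K} :
    x ∈ rightNullSpace F G ↔ F.map (algebraMap K (RatFunc K)) *ᵥ (RatFunc.X (K := K) • x) =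
      G.map (algebraMap K (RatFunc K)) *ᵥ x := by
  rw [rightNullSpace, LinearMap.mem_ker, mulVecLin_apply, pencil, sub_mulVec, sub_eq_zero,
    smul_mulVec, mulVec_smul]

namespace IsKroneckerTransformation

variable {K : Type*} [Field K] {R C : Type*} [Fintype R] [Fintype C] [DecidableEq R]
  [DecidableEq C] {F G : Matrix R C K} {κ : KroneckerInvariants K} {P : Matrix κ.Row R K}
  {Q : Matrix C κ.Col K}

/-- `P` and `Q` stay invertible over `K(s)`, so `Q` carries the canonical null space onto that of
the pencil. -/
theorem finrank_rightNullSpace_eq_zero_iff (h : IsKroneckerTransformation F G κ P Q) :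
    Module.finrank (RatFunc K) (rightNullSpace F G) = 0 ↔ κ.c = 0 ∧ κ.g = 0 := by
  obtain ⟨P', -, hP⟩ := h.nonsingular_P
  obtain ⟨Q', hQ, hQ'⟩ := h.nonsingular_Q
  set f := algebraMap K (RatFunc K)
  have hPm : P'.map f * P.map f = 1 := by
    rw [← Matrix.map_mul, hP]; exact Matrix.map_one f (map_zero f) (map_one f)
  have hQm : Q.map f * Q'.map f = 1 := by
    rw [← Matrix.map_mul, hQ]; exact Matrix.map_one f (map_zero f) (map_one f)
  have hQm' : Q'.map f * Q.map f = 1 := by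
    rw [← Matrix.map_mul, hQ']; exact Matrix.map_one f (map_zero f) (map_one f)
  have hmem (z : κ.Col → RatFunc K) : Q.map f *ᵥ z ∈ rightNullSpace F G ↔
      κ.FK.map f *ᵥ (RatFunc.X (K := K) • z) = κ.GK.map f *ᵥ z := by
    rw [mem_rightNullSpace_iff, ← mulVec_smul, mulVec_eq_mulVec_iff_of_equivalence hPm,
      ← Matrix.map_mul, ← Matrix.map_mul, ← Matrix.map_mul, ← Matrix.map_mul, h.transform_F,
      h.transform_G]
  rw [Submodule.finrank_eq_zero, Submodule.eq_bot_iff, ← κ.canonical_null_space_trivial_iff]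
  constructor
  · intro hx z hz
    have := hx _ ((hmem z).2 hz)
    simpa [mulVec_mulVec, hQm'] using congrArg (Q'.map f *ᵥ ·) this
  · intro hz x hx
    have hQx : Q.map f *ᵥ (Q'.map f *ᵥ x) = x := by rw [mulVec_mulVec, hQm, one_mulVec]
    have hx' : Q'.map f *ᵥ x = 0 := hz _ ((hmem _).1 (by rwa [hQx]))
    rw [← hQx, hx', mulVec_zero]

theorem isSolution_iff (h : IsKroneckerTransformation F G κ P Q) {N : Matrix κ.Col C K}
    (hQN : Q * N = 1) {k₀ : ℤ} {Y₀ : C → K} {Y : Set.Ici k₀ → C → K} :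
    IsSolution F G k₀ Y₀ Y ↔ N *ᵥ Y (timeEquiv k₀ 0) = N *ᵥ Y₀ ∧
      ∀ m, κ.FK *ᵥ (N *ᵥ Y (timeEquiv k₀ (m + 1))) = κ.GK *ᵥ (N *ᵥ Y (timeEquiv k₀ m)) := by
  obtain ⟨P', -, hP⟩ := h.nonsingular_P
  have hQ (y : C → K) : Q *ᵥ (N *ᵥ y) = y := by rw [mulVec_mulVec, hQN, one_mulVec]
  rw [isSolution_iff_nat]
  refine and_congr ⟨fun e => by rw [e], fun e => ?_⟩ (forall_congr' fun m => ?_)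
  · rw [← hQ Y₀, ← e, hQ]
  · rw [← h.transform_F, ← h.transform_G, ← mulVec_eq_mulVec_iff_of_equivalence hP, hQ, hQ]

/-- Solutions correspond to solutions of the canonical system through `Y = Q Z`. -/
theorem isSolution_mulVec_iff (h : IsKroneckerTransformation F G κ P Q) {N : Matrix κ.Col C K}
    (hQN : Q * N = 1) (hNQ : N * Q = 1) {k₀ : ℤ} {Y₀ : C → K} {Z : ℕ → κ.Col → K} :
    IsSolution F G k₀ Y₀ (fun k => Q *ᵥ Z ((timeEquiv k₀).symm k)) ↔
      Z 0 = N *ᵥ Y₀ ∧ ∀ m, κ.FK *ᵥ Z (m + 1) = κ.GK *ᵥ Z m := by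
  rw [h.isSolution_iff hQN]
  simp [mulVec_mulVec, hNQ]

theorem exists_isSolution_iff (h : IsKroneckerTransformation F G κ P Q) {N : Matrix κ.Col C K}
    (hQN : Q * N = 1) (hNQ : N * Q = 1) {k₀ : ℤ} {Y₀ : C → K} :
    (∃ Y, IsSolution F G k₀ Y₀ Y) ↔ κ.IsConsistent (N *ᵥ Y₀) := by
  constructor
  · rintro ⟨Y, hY⟩
    obtain ⟨h0, hrec⟩ := (h.isSolution_iff hQN).1 hY
    rw [← h0]
    exact κ.isConsistent_of_recurrence (Z := fun m => N *ᵥ Y (timeEquiv k₀ m)) hrec 0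
  · intro hc
    exact ⟨_, (h.isSolution_mulVec_iff hQN hNQ (Z := κ.freeSolution (N *ᵥ Y₀) 0)).2
      ⟨κ.freeSolution_zero hc 0, κ.freeSolution_recurrence _ 0⟩⟩

theorem infinite_isSolution (h : IsKroneckerTransformation F G κ P Q)
    (hcg : ¬ (κ.c = 0 ∧ κ.g = 0)) {k₀ : ℤ} {Y₀ : C → K} (hex : ∃ Y, IsSolution F G k₀ Y₀ Y) :
    {Y | IsSolution F G k₀ Y₀ Y}.Infinite := by
  obtain ⟨N, hQN, hNQ⟩ := h.nonsingular_Q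
  have hinf := κ.infinite_recurrence_solutions hcg ((h.exists_isSolution_iff hQN hNQ).1 hex)
  have hinj : Function.Injective
      fun (Z : ℕ → κ.Col → K) (k : Set.Ici k₀) => Q *ᵥ Z ((timeEquiv k₀).symm k) := by
    intro Z Z' e
    ext1 m
    have := congrArg (N *ᵥ ·) (congrFun e (timeEquiv k₀ m))
    simpa [mulVec_mulVec, hNQ] using this
  refine (hinf.image hinj.injOn).mono ?_
  rintro _ ⟨Z, hZ, rfl⟩
  exact (h.isSolution_mulVec_iff hQN hNQ).2 hZ

theorem mem_colspan_sup_iff {N : Matrix κ.Col C K} (hQN : Q * N = 1) (hNQ : N * Q = 1)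
    {Y₀ : C → K} :
    Y₀ ∈ colspan (κ.Qp Q) ⊔ colspan (κ.Qeps Q) ⊔ colspan (κ.Qg Q) ↔
      κ.IsConsistent (N *ᵥ Y₀) := by
  have hQ : Q *ᵥ (N *ᵥ Y₀) = Y₀ := by rw [mulVec_mulVec, hQN, one_mulVec]
  simp only [Submodule.mem_sup, mem_colspan_iff]
  constructor
  · rintro ⟨_, ⟨_, ⟨a, rfl⟩, _, ⟨b, rfl⟩, rfl⟩, _, ⟨d, rfl⟩, rfl⟩
    rw [← κ.mulVec_colVec, mulVec_mulVec, hNQ, one_mulVec]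
    exact ⟨fun _ => rfl, fun _ => rfl⟩
  · intro hc
    rw [← hQ, hc.eq_colVec, κ.mulVec_colVec]
    exact ⟨_, ⟨_, ⟨_, rfl⟩, _, ⟨_, rfl⟩, rfl⟩, _, ⟨_, rfl⟩, rfl⟩

theorem mem_colspan_Qp_of_isConsistent {N : Matrix κ.Col C K} (hQN : Q * N = 1)
    (hcg : κ.c = 0 ∧ κ.g = 0) {Y₀ : C → K} (hc : κ.IsConsistent (N *ᵥ Y₀)) :
    Y₀ ∈ colspan (κ.Qp Q) := by
  refine mem_colspan_iff.2 ⟨fun i => (N *ᵥ Y₀) (.inl i), ?_⟩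
  have hQ : Q *ᵥ (N *ᵥ Y₀) = Y₀ := by rw [mulVec_mulVec, hQN, one_mulVec]
  rw [← κ.mulVec_colVec_zero_zero]
  conv_rhs => rw [← hQ, hc.eq_colVec]
  congr 2
  · ext i
    exact absurd i.1.2 (by omega)
  · ext i
    exact absurd i.2 (by omega)

/-- Without column minimal indices, the solution is given by the powers of `J_p`. -/
theorem isSolution_iff_eq_Qp_mulVec (h : IsKroneckerTransformation F G κ P Q)
    (hcg : κ.c = 0 ∧ κ.g = 0) {k₀ : ℤ} {z : κ.IdxP → K} {Y : Set.Ici k₀ → C → K} :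
    IsSolution F G k₀ (κ.Qp Q *ᵥ z) Y ↔
      ∀ k : Set.Ici k₀, Y k = κ.Qp Q *ᵥ (κ.Jp ^ (k.1 - k₀).toNat *ᵥ z) := by
  obtain ⟨N, hQN, hNQ⟩ := h.nonsingular_Q
  have hQ (y : C → K) : Q *ᵥ (N *ᵥ y) = y := by rw [mulVec_mulVec, hQN, one_mulVec]
  have hN : N *ᵥ (κ.Qp Q *ᵥ z) = κ.colVec z 0 0 := by
    rw [← κ.mulVec_colVec_zero_zero, mulVec_mulVec, hNQ, one_mulVec]
  have hb (b : κ.ColEps → K) : b = 0 := funext fun i => absurd i.1.2 (by omega)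
  have hd (d : Fin κ.g → K) : d = 0 := funext fun i => absurd i.2 (by omega)
  constructor
  · intro hY k
    obtain ⟨h0, hrec⟩ := (h.isSolution_iff hQN).1 hY
    have hm (m : ℕ) : Y (timeEquiv k₀ m) = κ.Qp Q *ᵥ (κ.Jp ^ m *ᵥ z) := by
      have hc := (κ.isConsistent_of_recurrence (Z := fun m => N *ᵥ Y (timeEquiv k₀ m)) hrec
        m).eq_colVec
      have hp := κ.finite_part_of_recurrence (Z := fun m => N *ᵥ Y (timeEquiv k₀ m)) hrec m
      rw [hb fun _ => _, hd fun _ => _, hp, h0, hN] at hc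
      rw [← hQ (Y _), hc, κ.mulVec_colVec_zero_zero]
      rfl
    have := hm ((timeEquiv k₀).symm k)
    rwa [Equiv.apply_symm_apply] at this
  · intro hY
    -- With `c = g = 0` nothing is free, so the control sequence may be taken to be zero.
    have hY' : Y = fun k => Q *ᵥ κ.freeSolution (κ.colVec z 0 0) 0 ((timeEquiv k₀).symm k) := by
      ext1 k
      rw [hY, KroneckerInvariants.freeSolution, hb fun _ => _, hd fun _ => _, κ.mulVec_colVec_zero_zero]
      rfl
    rw [hY', h.isSolution_mulVec_iff hQN hNQ, hN]
    exact ⟨κ.freeSolution_zero ⟨fun _ => rfl, fun _ => rfl⟩ 0, κ.freeSolution_recurrence _ 0⟩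

end IsKroneckerTransformation

/-! ### The main theorem -/

theorem theorem3p1 {K : Type*} [Field K] {n m₁ r₁ : ℕ} (hn : 1 ≤ n)
    (A : Fin (n + 1) → Matrix (Fin m₁) (Fin r₁) K)
    (hsing : IsSingularPencil (sysF A) (sysG A))
    (κ : KroneckerInvariants K)
    (P : Matrix κ.Row (SysRow n m₁ r₁) K) (Q : Matrix (SysCol n r₁) κ.Col K)
    (hPQ : IsKroneckerTransformation (sysF A) (sysG A) κ P Q)
    (k₀ : ℤ) (Y₀ : SysCol n r₁ → K) :
    -- the solution is unique (it exists and there is no other) iff both conditions hold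
    ((∃! Y, IsSolution (sysF A) (sysG A) k₀ Y₀ Y) ↔
      Module.finrank (RatFunc K) (rightNullSpace (sysF A) (sysG A)) = 0 ∧
        Y₀ ∈ colspan (κ.Qp Q)) ∧
    -- the formula for the unique solution
    (Module.finrank (RatFunc K) (rightNullSpace (sysF A) (sysG A)) = 0 ∧
        Y₀ ∈ colspan (κ.Qp Q) →
      ∃ z : κ.IdxP → K, (Y₀ = κ.Qp Q *ᵥ z ∧ ∀ z', Y₀ = κ.Qp Q *ᵥ z' → z' = z) ∧
        ∀ Y, IsSolution (sysF A) (sysG A) k₀ Y₀ Y ↔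
          ∀ k : Set.Ici k₀, Y k = κ.Qp Q *ᵥ (κ.Jp ^ (k.1 - k₀).toNat *ᵥ z)) ∧
    -- the consistent initial values, those for which there is a solution
    ((∃ Y, IsSolution (sysF A) (sysG A) k₀ Y₀ Y) ↔
      Y₀ ∈ colspan (κ.Qp Q) ⊔ colspan (κ.Qeps Q) ⊔ colspan (κ.Qg Q)) ∧
    -- in any other case a consistent initial value has infinitely many solutions
    (¬ (Module.finrank (RatFunc K) (rightNullSpace (sysF A) (sysG A)) = 0 ∧
        Y₀ ∈ colspan (κ.Qp Q)) →
      (∃ Y, IsSolution (sysF A) (sysG A) k₀ Y₀ Y) →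
        {Y | IsSolution (sysF A) (sysG A) k₀ Y₀ Y}.Infinite) := by
  obtain ⟨N, hQN, hNQ⟩ := hPQ.nonsingular_Q
  rw [hPQ.finrank_rightNullSpace_eq_zero_iff]
  have hformula : (κ.c = 0 ∧ κ.g = 0) ∧ Y₀ ∈ colspan (κ.Qp Q) →
      ∃ z : κ.IdxP → K, (Y₀ = κ.Qp Q *ᵥ z ∧ ∀ z', Y₀ = κ.Qp Q *ᵥ z' → z' = z) ∧
        ∀ Y, IsSolution (sysF A) (sysG A) k₀ Y₀ Y ↔
          ∀ k : Set.Ici k₀, Y k = κ.Qp Q *ᵥ (κ.Jp ^ (k.1 - k₀).toNat *ᵥ z) := by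
    rintro ⟨hcg, hY₀⟩
    obtain ⟨z, rfl⟩ := mem_colspan_iff.1 hY₀
    exact ⟨z, ⟨rfl, fun z' e => κ.Qp_mulVec_injective hNQ e.symm⟩,
      fun Y => hPQ.isSolution_iff_eq_Qp_mulVec hcg⟩
  have hinfinite : ¬ ((κ.c = 0 ∧ κ.g = 0) ∧ Y₀ ∈ colspan (κ.Qp Q)) →
      (∃ Y, IsSolution (sysF A) (sysG A) k₀ Y₀ Y) →
        {Y | IsSolution (sysF A) (sysG A) k₀ Y₀ Y}.Infinite := by
    intro hne hex
    -- If `c = g = 0`, solvability alone would put `Y₀` in the span of `Q_p`, contrary to `hne`.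
    exact hPQ.infinite_isSolution (fun hcg => hne ⟨hcg,
      IsKroneckerTransformation.mem_colspan_Qp_of_isConsistent hQN hcg
        ((hPQ.exists_isSolution_iff hQN hNQ).1 hex)⟩) hex
  refine ⟨⟨fun hY => ?_, fun hcond => ?_⟩, hformula, ?_, hinfinite⟩
  · by_contra hne
    obtain ⟨Y, hsol, huniq⟩ := hY
    exact hinfinite hne ⟨Y, hsol⟩ ((Set.finite_singleton Y).subset fun Y' h => huniq Y' h)
  · obtain ⟨z, -, hz⟩ := hformula hcond
    exact ⟨_, (hz _).2 fun _ => rfl, fun Y hY => funext ((hz Y).1 hY)⟩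
  · rw [hPQ.exists_isSolution_iff hQN hNQ,
      IsKroneckerTransformation.mem_colspan_sup_iff hQN hNQ]
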